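/- Let $K$ be a field, $\overline K$ an algebraic closure of $K$, $\nu$ a valuation on $K[x]$ with values in $\Gamma\cup\{\infty\}$ ($\Gamma$ a linearly ordered abelian group, $\nu(f)=\infty$ only for $f=0$), and $\mu$ an extension of $\nu$ to $\overline K[x]$. For $f\in K[x]$ nonconstant put $\delta(f)=\max\{\mu(x-a)\mid a\in\overline K,\ f(a)=0\}$ and $\epsilon(f)=\max_{r\ge 1}\frac{\nu(f)-\nu(\partial_r f)}{r}$ (a maximum in $\Gamma\otimes\mathbb Q$ over the $r$ with $\partial_r f\neq 0$), where $\partial_r f$ are the Taylor coefficients, $f(x+y)=\sum_{r\ge 0}\partial_rf(x)\,y^r$; for constant $f$ put $\epsilon(f)=-\infty$. A monic $Q\in K[x]$ is a *key polynomial* for $\nu$ if every $f\in K[x]$ with $\epsilon(f)\ge\epsilon(Q)$ satisfies $\deg f\ge\deg Q$. For nonconstant $q\in K[x]$ the *$q$-truncation* of $\nu$ is $\nu_q(p)=\min_i\nu(p_iq^i)$, where $p=\sum_i p_iq^i$ with $p_i=0$ or $\deg p_i<\deg q$. Let $\mu(\overline K[x])$ be the subgroup of $\Gamma$ generated by the finite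 values of $\mu$. A pair $(a,\delta)\in\overline K\times\mu(\overline K[x])$ is a *minimal pair* for $\nu$ if $[K(b):K]\ge[K(a):K]$ for every $b\in\overline K$ with $\mu(b-a)\ge\delta$. It is a *minimal pair of definition* for $\nu$ if in addition $\mu(x-a)=\delta\ge\mu(x-b)$ for every $b\in\overline K$. **Theorem.** Let $Q\in K[x]$ be monic irreducible, and let $a\in\overline K$ be a root of $Q$ with $\mu(x-a)=\delta(Q)$. Then $Q$ is a key polynomial for $\nu$ if and only if $(a,\delta(Q))$ is a minimal pair for $\nu$. Moreover, if $Q$ is a key polynomial for $\nu$, then $(a,\delta(Q))$ is a minimal pair of definition for $\nu$ if and only if $\nu=\nu_Q$. Without assuming that $Q$ is a key polynomial: if $(a,\delta(Q))$ is a minimal pair of definition for $\nu$, then $\nu=\nu_Q$; and if $\nu=\nu_Q$, then $\mu(x-a)\ge\mu(x-b)$ for every $b\in\overline K$. -/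

import Mathlib

open Polynomial

namespace KeyPoly

noncomputable section

section Base

variable {K : Type*} [Field K]
variable {Γ : Type*} [AddCommGroup Γ] [LinearOrder Γ] [IsOrderedAddMonoid Γ]

/-- `ε(f) = max_{r ≥ 1} (ν(f) - ν(∂_r f)) / r`, where `∂_r` is the `r`-th Hasse derivative, i.e. the
`r`-th coefficient of the Taylor expansion. The quotients live in the divisible hull
of the group `Γ`. The indices `r` with `ν(∂_r f) = ∞` (in particular all `r > deg f`) contribute
`-∞`, so only the remaining ones are listed; `ε(f) = ⊥ = -∞` if `f` is constant.
When `ν(f) ≠ ∞`, the two `untopD 0` below read off genuine finite values. -/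
def epsilon (ν : AddValuation K[X] (WithTop Γ)) (f : K[X]) : WithBot (DivisibleHull Γ) :=
  (((Finset.range f.natDegree).filter fun s => ν (hasseDeriv (s + 1) f) ≠ ⊤).image fun s =>
    DivisibleHull.mk ((ν f).untopD 0 - (ν (hasseDeriv (s + 1) f)).untopD 0) s.succPNat).max

/-- `Q` is a key polynomial for `ν`. -/
def IsKeyPolynomial (ν : AddValuation K[X] (WithTop Γ)) (Q : K[X]) : Prop :=
  Q.Monic ∧ ∀ f : K[X], epsilon ν Q ≤ epsilon ν f → Q.natDegree ≤ f.natDegree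

/-- The `i`-th coefficient `p_i` of the `q`-expansion `p = p_0 + p_1 q + p_2 q ^ 2 + ⋯`,
obtained by repeated division with remainder by `q`. -/
def expansionCoeff (q p : K[X]) (i : ℕ) : K[X] := ((fun g : K[X] => g / q)^[i] p) % q

theorem degree_expansionCoeff_lt {q : K[X]} (hq : q ≠ 0) (p : K[X]) (i : ℕ) :
    (expansionCoeff q p i).degree < q.degree :=
  EuclideanDomain.mod_lt _ hq

theorem sum_expansionCoeff {q : K[X]} (hq : 0 < q.natDegree) (p : K[X]) :
    ∑ i ∈ Finset.range (p.natDegree + 1), expansionCoeff q p i * q ^ i = p := by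
  have key : ∀ n (p : K[X]), ∑ i ∈ Finset.range n, expansionCoeff q p i * q ^ i
      + ((fun g : K[X] => g / q)^[n] p) * q ^ n = p := by
    intro n p
    induction n with
    | zero => simp
    | succ n ih =>
      rw [Finset.sum_range_succ, Function.iterate_succ_apply']
      conv_rhs => rw [← ih]
      rw [add_assoc, expansionCoeff]
      congr 1
      conv_rhs => rw [← EuclideanDomain.mod_add_div ((fun g : K[X] => g / q)^[n] p) q]
      ring
  have van : ∀ n (p : K[X]), p.natDegree < n → (fun g : K[X] => g / q)^[n] p = 0 := by
    intro n
    induction n with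
    | zero => intro p h; omega
    | succ n ih =>
      intro p h
      rw [Function.iterate_succ_apply]
      by_cases h0 : n = 0
      · subst h0
        have hd : p.degree < q.degree := by
          apply Polynomial.degree_lt_degree
          omega
        simpa using (Polynomial.div_eq_zero_iff (by rintro rfl; simp at hq)).2 hd
      · apply ih
        by_cases hp : p = 0
        · subst hp
          simpa using Nat.pos_of_ne_zero h0
        · have hq0 : 0 < q.degree := Polynomial.natDegree_pos_iff_degree_pos.1 hq
          have hlt := Polynomial.degree_div_lt hp hq0
          have : (p / q).natDegree < n ∨ p / q = 0 := by
            by_cases hz : p / q = 0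
            · exact Or.inr hz
            · have := Polynomial.natDegree_lt_natDegree hz hlt
              left; omega
          rcases this with h1 | h1
          · exact h1
          · rw [h1]
            simpa using Nat.pos_of_ne_zero h0
  have := key (p.natDegree + 1) p
  rwa [van _ p (Nat.lt_succ_self _), zero_mul, add_zero] at this

/-- The `q`-truncation `ν_q(p) = min_i ν(p_i q ^ i)` (for nonconstant `q`), the minimum being over
the `q`-expansion of `p`, which has at most `deg p + 1` nonzero terms. -/
def truncation (ν : AddValuation K[X] (WithTop Γ)) (q p : K[X]) : WithTop Γ :=
  (Finset.range (p.natDegree + 1)).inf fun i => ν (expansionCoeff q p i * q ^ i)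

/-- The value group of a valuation on a ring: the subgroup of `Γ` generated by
the finite values. -/
def valueGroup {R : Type*} [CommRing R] (μ : AddValuation R (WithTop Γ)) : AddSubgroup Γ :=
  AddSubgroup.closure {γ | ∃ g : R, μ g = (γ : WithTop Γ)}

end Base

section Extension

variable (K : Type*) [Field K] {L : Type*} [Field L] [Algebra K L]
variable {Γ : Type*} [AddCommGroup Γ] [LinearOrder Γ] [IsOrderedAddMonoid Γ]

/-- `(a, δ)` is a minimal pair; here `L` is the algebraic closure of `K`
and `μ` is the chosen extension to `L[x]` of the valuation on `K[x]`. -/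
def IsMinimalPair (μ : AddValuation L[X] (WithTop Γ)) (a : L) (δ : Γ) : Prop :=
  δ ∈ valueGroup μ ∧
    ∀ b : L, (δ : WithTop Γ) ≤ μ (C (b - a)) →
      Module.finrank K (IntermediateField.adjoin K {a}) ≤
        Module.finrank K (IntermediateField.adjoin K {b})

/-- `(a, δ)` is a minimal pair of definition. -/
def IsMinimalPairOfDefinition (μ : AddValuation L[X] (WithTop Γ)) (a : L) (δ : Γ) : Prop :=
  IsMinimalPair K μ a δ ∧ μ (X - C a) = (δ : WithTop Γ) ∧
    ∀ b : L, μ (X - C b) ≤ (δ : WithTop Γ)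

variable {K}

open Classical in
/-- `δ(f) = max {μ(x - a) | a a root of f in L}` (it is `⊥` if there are no roots). -/
def delta (μ : AddValuation L[X] (WithTop Γ)) (f : K[X]) : WithBot (WithTop Γ) :=
  ((f.aroots L).toFinset.image fun a => μ (X - C a)).max

end Extension

end

end KeyPoly

/-! Over L a nonzero polynomial splits, so properties of μ need only be checked on constants and on
X - c and be stable under products. Newton polygons of Taylor coefficients behave well under
products, which gives ε(f) = max μ(X - c) over the roots c of a nonconstant f
(`epsilon_eq_of_root`). So ε(f) ≥ ε(Q) means that f has a root b with μ(X - b) ≥ δ, equivalently μ(b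
- a) ≥ δ, and the first equivalence compares degrees of such b.

For truncations: if every root of f is farther from X than b, then f may be replaced by the constant
f(b) (`val_lt_val_sub_eval`). For a minimal pair of definition this turns a Q-expansion into a
polynomial in Q with constant coefficients, where μ is the minimum over the terms (`val_comp_le`).
Conversely, if ν = ν_Q, some b closer to X than a, of least degree over K, leads to a contradiction
by evaluating at b. -/

namespace KeyPoly

/-! ### Ultrametric inequalities -/

section Linear

variable {R : Type*} [CommRing R]
variable {Γ : Type*} [AddCommGroup Γ] [LinearOrder Γ] [IsOrderedAddMonoid Γ]
variable {μ : AddValuation R[X] (WithTop Γ)}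

theorem val_lt_val_sub {f g : R[X]} {γ : WithTop Γ} (hf : γ < μ f) (hg : γ < μ g) :
    γ < μ (f - g) := by
  rw [sub_eq_add_neg]
  exact μ.map_lt_add hf (by rwa [μ.map_neg])

theorem le_val_C_sub {a b : R} {γ : WithTop Γ} (ha : γ ≤ μ (X - C a)) (hb : γ ≤ μ (X - C b)) :
    γ ≤ μ (C (a - b)) := by
  have : C (a - b) = (X - C b) - (X - C a : R[X]) := by simp
  rw [this]
  exact μ.map_le_sub hb ha

theorem le_val_X_sub_C {a b : R} {γ : WithTop Γ} (ha : γ ≤ μ (X - C a)) (h : γ ≤ μ (C (a - b))) :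
    γ ≤ μ (X - C b) := by
  have : (X - C b : R[X]) = (X - C a) + C (a - b) := by simp
  rw [this]
  exact μ.map_le_add ha h

end Linear

/-! ### Values of polynomials via linear factors -/

section Factorization

variable {L : Type*} [Field L] [IsAlgClosed L]
variable {Γ : Type*} [AddCommGroup Γ] [LinearOrder Γ] [IsOrderedAddMonoid Γ]

/-- Induction along the factorization of a nonzero polynomial into linear factors. -/
theorem induction_on_roots {P : L[X] → Prop} {f : L[X]} (hf : f ≠ 0)
    (const : ∀ c : L, c ≠ 0 → P (C c)) (linear : ∀ c : L, f.IsRoot c → P (X - C c))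
    (mul : ∀ p q : L[X], P p → P q → P (p * q)) : P f := by
  rw [(IsAlgClosed.splits f).eq_prod_roots]
  refine mul _ _ (const _ (leadingCoeff_ne_zero.2 hf)) ?_
  refine Multiset.prod_induction P _ mul (by simpa using const 1 one_ne_zero) ?_
  intro p hp
  obtain ⟨c, hc, rfl⟩ := Multiset.mem_map.1 hp
  exact linear c (isRoot_of_mem_roots hc)

/-- X - c divides the image of the minimal polynomial of c, whose value is finite. -/
theorem eq_zero_of_val_eq_top {K : Type*} [Field K] [Algebra K L] [Algebra.IsAlgebraic K L]
    {ν : AddValuation K[X] (WithTop Γ)} (hν : ∀ f : K[X], ν f = ⊤ → f = 0)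
    {μ : AddValuation L[X] (WithTop Γ)} (hμ : ∀ f : K[X], μ (f.map (algebraMap K L)) = ν f)
    (f : L[X]) (h : μ f = ⊤) : f = 0 := by
  by_contra hf
  revert h
  refine induction_on_roots (P := fun f => μ f ≠ ⊤) hf ?_ ?_ ?_
  · intro c hc h
    have := μ.map_mul (C c) (C c⁻¹)
    rw [← C_mul, mul_inv_cancel₀ hc, C_1, μ.map_one, h, top_add] at this
    exact WithTop.zero_ne_top this
  · intro c _ h
    have hc : (minpoly K c).map (algebraMap K L) =
        (X - C c) * ((minpoly K c).map (algebraMap K L) / (X - C c)) := by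
      symm
      rw [mul_div_eq_iff_isRoot]
      simp [IsRoot, eval_map_algebraMap]
    have := hμ (minpoly K c)
    rw [hc, μ.map_mul, h, top_add] at this
    exact minpoly.ne_zero (Algebra.IsIntegral.isIntegral c) (hν _ this.symm)
  · intro p q hp hq
    rw [μ.map_mul]
    exact WithTop.add_ne_top.2 ⟨hp, hq⟩

variable {μ : AddValuation L[X] (WithTop Γ)} (hμ : ∀ f : L[X], μ f = ⊤ → f = 0)

include hμ in
/-- A polynomial all of whose roots are further from `X` than `b` is equivalent to its value
at `b`. -/
theorem val_lt_val_sub_eval {f : L[X]} (hf : f ≠ 0) {b : L}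
    (hb : ∀ c : L, f.IsRoot c → μ (X - C c) < μ (X - C b)) :
    μ f < μ (f - C (f.eval b)) := by
  refine induction_on_roots (P := fun f => μ f < μ (f - C (f.eval b))) hf ?_ ?_ ?_
  · intro c hc
    simpa using lt_top_iff_ne_top.2 fun h => hc (by simpa using hμ _ h)
  · intro c hc
    simpa using hb c hc
  · intro p q hp hq
    have hp' : μ (C (p.eval b)) = μ p :=
      μ.map_eq_of_lt_sub (by rwa [μ.map_sub_swap])
    have e : p * q - C ((p * q).eval b)
        = (p - C (p.eval b)) * q + C (p.eval b) * (q - C (q.eval b)) := by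
      simp only [eval_mul, C_mul]
      ring
    rw [e]
    have hpt : μ p ≠ ⊤ := ne_top_of_lt hp
    have hqt : μ q ≠ ⊤ := ne_top_of_lt hq
    apply μ.map_lt_add
    · rw [μ.map_mul, μ.map_mul]
      exact WithTop.add_lt_add_right hqt hp
    · rw [μ.map_mul, μ.map_mul, hp']
      exact WithTop.add_lt_add_left hpt hq

/-- For a linear factor, a - c = (X - c) - (X - a), and X - a has at least the value of X - c. -/
theorem val_le_val_C_eval {a : L} (ha : ∀ b : L, μ (X - C b) ≤ μ (X - C a)) (f : L[X]) :
    μ f ≤ μ (C (f.eval a)) := by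
  by_cases hf : f = 0
  · simp [hf]
  refine induction_on_roots (P := fun f => μ f ≤ μ (C (f.eval a))) hf ?_ ?_ ?_
  · simp
  · intro c _
    simpa only [eval_sub, eval_X, eval_C] using le_val_C_sub (ha c) le_rfl
  · intro p q hp hq
    simpa only [eval_mul, C_mul, μ.map_mul] using add_le_add hp hq

/-- There is no cancellation between powers of y: for g = X - c, both c and y have value at least
μ(y - c), and the coefficients of a product are convolutions. -/
theorem val_comp_le {y : L[X]} (hy : ∀ d : L, μ (y - C d) ≤ μ y) (g : L[X]) (i : ℕ) :
    μ (g.comp y) ≤ μ (C (g.coeff i) * y ^ i) := by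
  by_cases hg : g = 0
  · simp [hg]
  revert i
  refine induction_on_roots (P := fun g => ∀ i, μ (g.comp y) ≤ μ (C (g.coeff i) * y ^ i)) hg
    ?_ ?_ ?_
  · intro c _ i
    rcases i with _ | i
    · simp
    · simp
  · intro c _ i
    rcases i with _ | _ | i
    · have : C c = y - (y - C c) := by ring
      simp only [sub_comp, X_comp, C_comp, coeff_sub, coeff_X_zero, coeff_C_zero, zero_sub,
        pow_zero, mul_one, C_neg, μ.map_neg]
      rw [this]
      exact μ.map_le_sub (by simpa using hy c) (by simp)
    · simpa [coeff_X, coeff_C] using hy c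
    · simp [coeff_X]
  · intro p q hp hq k
    have e : C ((p * q).coeff k) * y ^ k = ∑ ij ∈ Finset.HasAntidiagonal.antidiagonal k,
        (C (p.coeff ij.1) * y ^ ij.1) * (C (q.coeff ij.2) * y ^ ij.2) := by
      rw [coeff_mul, map_sum, Finset.sum_mul]
      refine Finset.sum_congr rfl fun ij hij => ?_
      rw [← Finset.HasAntidiagonal.mem_antidiagonal.1 hij, C_mul, pow_add]
      ring
    rw [e]
    refine μ.map_le_sum fun ij _ => ?_
    rw [mul_comp, μ.map_mul, μ.map_mul]
    exact add_le_add (hp _) (hq _)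

end Factorization

/-! ### Newton polygons of Taylor coefficients -/

section Taylor
variable {R : Type*} [CommRing R]
variable {Γ : Type*} [AddCommGroup Γ] [LinearOrder Γ] [IsOrderedAddMonoid Γ]

/-- The points `(r, μ (∂_r f))` lie on or above the line of slope `-γ` through `(0, μ f)`, and
`(N, μ (∂_N f))` is the last one on it. -/
structure TouchesAt (μ : AddValuation R[X] (WithTop Γ)) (γ : Γ) (f : R[X]) (N : ℕ) : Prop where
  ne_top : μ f ≠ ⊤
  le : ∀ r, μ f ≤ μ (hasseDeriv r f) + ((r • γ : Γ) : WithTop Γ)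
  eq : μ f = μ (hasseDeriv N f) + ((N • γ : Γ) : WithTop Γ)
  lt : ∀ r, N < r → μ f < μ (hasseDeriv r f) + ((r • γ : Γ) : WithTop Γ)

variable {μ : AddValuation R[X] (WithTop Γ)} {γ : Γ}

/-- As in Gauss's lemma: among the Leibniz terms of index N + M, only (N, M) has neither i > N nor j
> M, so all others lie strictly above the line and cannot cancel it. -/
theorem TouchesAt.mul {f g : R[X]} {N M : ℕ} (hf : TouchesAt μ γ f N) (hg : TouchesAt μ γ g M) :
    TouchesAt μ γ (f * g) (N + M) := by
  have e : ∀ i j : ℕ, μ (hasseDeriv i f * hasseDeriv j g) + (((i + j) • γ : Γ) : WithTop Γ)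
      = (μ (hasseDeriv i f) + ((i • γ : Γ) : WithTop Γ)) +
        (μ (hasseDeriv j g) + ((j • γ : Γ) : WithTop Γ)) := by
    intro i j
    rw [μ.map_mul, add_smul, WithTop.coe_add]
    abel
  -- Moving the finite shift to the other side isolates the Hasse derivative, so that the
  -- ultrametric inequality applies to its Leibniz sum.
  have cancel : ∀ (u v : WithTop Γ) (x : Γ), u ≤ v + x ↔ u + ((-x : Γ) : WithTop Γ) ≤ v := by
    intro u v x
    induction u <;> induction v <;>
      simp [← WithTop.coe_add, -WithTop.LinearOrderedAddCommGroup.coe_neg]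
  have cancel' : ∀ (u v : WithTop Γ) (x : Γ), u < v + x ↔ u + ((-x : Γ) : WithTop Γ) < v := by
    intro u v x
    induction u <;> induction v <;>
      simp [← WithTop.coe_add, ← sub_eq_add_neg, -WithTop.LinearOrderedAddCommGroup.coe_neg,
        sub_lt_iff_lt_add, -WithTop.LinearOrderedAddCommGroup.coe_sub, WithTop.coe_lt_coe]
  have hle : ∀ i j, μ (f * g) ≤
      μ (hasseDeriv i f * hasseDeriv j g) + (((i + j) • γ : Γ) : WithTop Γ) := by
    intro i j
    rw [e, μ.map_mul]
    exact add_le_add (hf.le i) (hg.le j)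
  have hlt : ∀ i j, N < i ∨ M < j → μ (f * g) <
      μ (hasseDeriv i f * hasseDeriv j g) + (((i + j) • γ : Γ) : WithTop Γ) := by
    rintro i j (h | h)
    · rw [e, μ.map_mul]
      exact WithTop.add_lt_add_of_lt_of_le hg.ne_top (hf.lt i h) (hg.le j)
    · rw [e, μ.map_mul]
      exact WithTop.add_lt_add_of_le_of_lt hf.ne_top (hf.le i) (hg.lt j h)
  have htop : μ (f * g) ≠ ⊤ := by
    rw [μ.map_mul]
    exact WithTop.add_ne_top.2 ⟨hf.ne_top, hg.ne_top⟩
  have htop' : ∀ k : ℕ, μ (f * g) + ((-(k • γ) : Γ) : WithTop Γ) ≠ ⊤ := fun k =>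
    WithTop.add_ne_top.2 ⟨htop, WithTop.coe_ne_top⟩
  refine ⟨htop, fun k => ?_, ?_, fun k hk => ?_⟩
  · rw [cancel, hasseDeriv_mul]
    refine μ.map_le_sum fun ij hij => ?_
    rw [← cancel, ← Finset.HasAntidiagonal.mem_antidiagonal.1 hij]
    exact hle _ _
  · have hmain : μ (hasseDeriv N f * hasseDeriv M g) =
        μ (f * g) + ((-((N + M) • γ) : Γ) : WithTop Γ) := by
      have := e N M
      rw [← hf.eq, ← hg.eq, ← μ.map_mul] at this
      rw [← this, add_assoc, ← WithTop.coe_add, add_neg_cancel, WithTop.coe_zero, add_zero]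
    have hval : μ (hasseDeriv (N + M) (f * g)) = μ (hasseDeriv N f * hasseDeriv M g) := by
      rw [hasseDeriv_mul, ← Finset.add_sum_erase _ _ (Finset.HasAntidiagonal.mem_antidiagonal.2 
        (rfl : (N, M).1 + (N, M).2 = N + M))]
      refine μ.map_add_eq_of_lt_left ?_
      simp only
      rw [hmain]
      refine μ.map_lt_sum (htop' _) fun ij hij => ?_
      obtain ⟨hne, hij⟩ := Finset.mem_erase.1 hij
      have hsum := Finset.HasAntidiagonal.mem_antidiagonal.1 hij
      rw [← cancel', ← hsum]
      apply hlt
      by_contra! h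
      exact hne (Prod.ext (by simp only; omega) (by simp only; omega))
    rw [hval, hmain, add_assoc, ← WithTop.coe_add, neg_add_cancel, WithTop.coe_zero, add_zero]
  · rw [cancel', hasseDeriv_mul]
    refine μ.map_lt_sum (htop' _) fun ij hij => ?_
    have hsum := Finset.HasAntidiagonal.mem_antidiagonal.1 hij
    rw [← cancel', ← hsum]
    apply hlt
    omega

theorem touchesAt_C {c : R} (hc : μ (C c) ≠ ⊤) : TouchesAt μ γ (C c) 0 := by
  have hlt : ∀ r, 0 < r → μ (C c) < μ (hasseDeriv r (C c)) + ((r • γ : Γ) : WithTop Γ) := by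
    intro r hr
    rw [hasseDeriv_C _ _ hr, μ.map_zero, top_add]
    exact lt_top_iff_ne_top.2 hc
  refine ⟨hc, fun r => ?_, by simp, hlt⟩
  rcases Nat.eq_zero_or_pos r with rfl | hr
  · simp
  · exact (hlt r hr).le

/-- Through products, N will count the roots of value exactly γ. -/
theorem touchesAt_X_sub_C {c : R} (h : μ (X - C c) ≤ γ) :
    ∃ N, TouchesAt μ γ (X - C c) N ∧ (μ (X - C c) = γ → N = 1) := by
  have htop : μ (X - C c) ≠ ⊤ := ne_top_of_le_ne_top WithTop.coe_ne_top h
  have h1 : μ (hasseDeriv 1 (X - C c)) + ((1 • γ : Γ) : WithTop Γ) = γ := by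
    simp
  have h2 : ∀ r, 1 < r → μ (X - C c) < μ (hasseDeriv r (X - C c)) + ((r • γ : Γ) : WithTop Γ) := by
    intro r hr
    rw [map_sub (hasseDeriv r), hasseDeriv_C _ _ (by omega), hasseDeriv_X _ hr, sub_zero,
      μ.map_zero, top_add]
    exact lt_top_iff_ne_top.2 htop
  have hle : ∀ r, μ (X - C c) ≤ μ (hasseDeriv r (X - C c)) + ((r • γ : Γ) : WithTop Γ) := by
    intro r
    rcases r with _ | _ | r
    · simp
    · exact h.trans_eq h1.symm
    · exact (h2 _ (by omega)).le
  rcases h.eq_or_lt with h | h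
  · exact ⟨1, ⟨htop, hle, h.trans h1.symm, h2⟩, fun _ => rfl⟩
  · refine ⟨0, ⟨htop, hle, by simp, fun r hr => ?_⟩, fun h' => absurd h' h.ne⟩
    rcases (show 1 ≤ r from hr).eq_or_lt with rfl | hr
    · exact h.trans_eq h1.symm
    · exact h2 r hr

end Taylor
-- Computing ε from the roots
section Epsilon

variable {K : Type*} [Field K]
variable {Γ : Type*} [AddCommGroup Γ] [LinearOrder Γ] [IsOrderedAddMonoid Γ]

/-- The line bounds every quotient by γ and the index N attains it; N = 0 would not do, as ε only
sees r ≥ 1. -/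
theorem TouchesAt.epsilon_eq {ν : AddValuation K[X] (WithTop Γ)} {γ : Γ} {f : K[X]} {N : ℕ}
    (h : TouchesAt ν γ f N) (hN : N ≠ 0) :
    epsilon ν f = (DivisibleHull.mk γ 1 : WithBot (DivisibleHull Γ)) := by
  obtain ⟨u, hu⟩ := WithTop.ne_top_iff_exists.1 h.ne_top
  apply le_antisymm
  · refine Finset.max_le fun x hx => ?_
    obtain ⟨s, hs, rfl⟩ := Finset.mem_image.1 hx
    obtain ⟨w, hw⟩ := WithTop.ne_top_iff_exists.1 (Finset.mem_filter.1 hs).2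
    have := h.le (s + 1)
    rw [← hu, ← hw, ← WithTop.coe_add, WithTop.coe_le_coe] at this
    rw [← hu, ← hw, WithBot.coe_le_coe, DivisibleHull.mk_le_mk]
    simpa [sub_le_iff_le_add, add_comm w] using this
  · obtain ⟨s, rfl⟩ := Nat.exists_eq_succ_of_ne_zero hN
    have hs := h.eq
    have htop : ν (hasseDeriv (s + 1) f) ≠ ⊤ := by
      intro h'
      rw [Nat.succ_eq_add_one, h', top_add] at hs
      exact h.ne_top hs
    obtain ⟨w, hw⟩ := WithTop.ne_top_iff_exists.1 htop
    rw [Nat.succ_eq_add_one, ← hu, ← hw, ← WithTop.coe_add, WithTop.coe_inj] at hs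
    refine Finset.le_max (Finset.mem_image.2 ⟨s, Finset.mem_filter.2 ⟨?_, htop⟩, ?_⟩)
    · rw [Finset.mem_range]
      by_contra! hd
      refine htop ?_
      rw [hasseDeriv_eq_zero_of_lt_natDegree _ _ (by omega), ν.map_zero]
    · rw [← hu, ← hw, DivisibleHull.mk_eq_mk_iff_smul_eq_smul, WithTop.untopD_coe,
        WithTop.untopD_coe, hs]
      simp

theorem epsilon_of_natDegree_eq_zero (ν : AddValuation K[X] (WithTop Γ)) {f : K[X]}
    (hf : f.natDegree = 0) : epsilon ν f = ⊥ := by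
  simp [epsilon, hf]

theorem map_hasseDeriv {R S : Type*} [Semiring R] [Semiring S] (φ : R →+* S) (r : ℕ) (f : R[X]) :
    (hasseDeriv r f).map φ = hasseDeriv r (f.map φ) := by
  ext n
  simp [hasseDeriv_coeff]

variable {L : Type*} [Field L] [IsAlgClosed L]
variable {μ : AddValuation L[X] (WithTop Γ)}

theorem exists_touchesAt (hμ : ∀ f : L[X], μ f = ⊤ → f = 0) {f : L[X]} (hf : f ≠ 0) {γ : Γ}
    (hγ : ∀ c : L, f.IsRoot c → μ (X - C c) ≤ γ) : ∃ N, TouchesAt μ γ f N := by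
  refine induction_on_roots (P := fun f => ∃ N, TouchesAt μ γ f N) hf ?_ ?_ ?_
  · intro c hc
    exact ⟨0, touchesAt_C fun h => hc (by simpa using hμ _ h)⟩
  · intro c hc
    obtain ⟨N, hN, -⟩ := touchesAt_X_sub_C (hγ c hc)
    exact ⟨N, hN⟩
  · rintro p q ⟨N, hN⟩ ⟨M, hM⟩
    exact ⟨N + M, hN.mul hM⟩

theorem exists_touchesAt_pos (hμ : ∀ f : L[X], μ f = ⊤ → f = 0) {f : L[X]} (hf : f ≠ 0) {γ : Γ}
    (hγ : ∀ c : L, f.IsRoot c → μ (X - C c) ≤ γ) {b : L} (hb : f.IsRoot b)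
    (hbγ : μ (X - C b) = γ) : ∃ N, N ≠ 0 ∧ TouchesAt μ γ f N := by
  -- Splitting off X - b contributes 1 to the last index, making it positive.
  obtain ⟨g, rfl⟩ := dvd_iff_isRoot.2 hb
  obtain ⟨N, hN⟩ := exists_touchesAt hμ (right_ne_zero_of_mul hf) (γ := γ)
    fun c hc => hγ c (root_mul_left_of_isRoot _ hc)
  obtain ⟨M, hM, h1⟩ := touchesAt_X_sub_C hbγ.le
  exact ⟨M + N, by rw [h1 hbγ]; omega, hM.mul hN⟩

variable [Algebra K L] {ν : AddValuation K[X] (WithTop Γ)}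

/-- `ε(f)` is the largest value `μ (X - b)` for `b` a root of `f`. -/
theorem epsilon_eq_of_root (hext : ∀ f : K[X], μ (f.map (algebraMap K L)) = ν f)
    (hμ : ∀ f : L[X], μ f = ⊤ → f = 0) {f : K[X]} (hf : f ≠ 0) {b : L} (hb : aeval b f = 0)
    {γ : Γ} (hbγ : μ (X - C b) = γ) (hγ : ∀ c : L, aeval c f = 0 → μ (X - C c) ≤ γ) :
    epsilon ν f = (DivisibleHull.mk γ 1 : WithBot (DivisibleHull Γ)) := by
  obtain ⟨N, hN, h⟩ := exists_touchesAt_pos hμ (f := f.map (algebraMap K L))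
    ((Polynomial.map_ne_zero_iff (algebraMap K L).injective).2 hf) (γ := γ)
    (fun c hc => hγ c (by simpa [IsRoot, eval_map_algebraMap] using hc))
    (by simpa [IsRoot, eval_map_algebraMap] using hb) hbγ
  have h' : TouchesAt ν γ f N :=
    { ne_top := by simpa only [hext] using h.ne_top
      le := by simpa only [← map_hasseDeriv, hext] using h.le
      eq := by simpa only [← map_hasseDeriv, hext] using h.eq
      lt := by simpa only [← map_hasseDeriv, hext] using h.lt }
  exact h'.epsilon_eq hN

theorem exists_max_root (μ : AddValuation L[X] (WithTop Γ)) {f : K[X]} (hf : f.natDegree ≠ 0) :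
    ∃ b : L, aeval b f = 0 ∧ ∀ c : L, aeval c f = 0 → μ (X - C c) ≤ μ (X - C b) := by
  classical
  have hf0 : f ≠ 0 := by
    rintro rfl
    simp at hf
  obtain ⟨b, hb⟩ := IsAlgClosed.exists_aeval_eq_zero L f
    (mt natDegree_eq_of_degree_eq_some hf)
  obtain ⟨b, hb, hmax⟩ := Finset.exists_max_image (f.aroots L).toFinset (fun c => μ (X - C c))
    ⟨b, by simp [hf0, hb]⟩
  simp only [Multiset.mem_toFinset, mem_aroots] at hb hmax
  exact ⟨b, hb.2, fun c hc => hmax c ⟨hf0, hc⟩⟩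

omit [IsAlgClosed L] in
theorem val_le_of_delta_eq {f : K[X]} (hf : f ≠ 0) {δ : Γ}
    (hδ : delta μ f = ((δ : WithTop Γ) : WithBot (WithTop Γ))) {c : L} (hc : aeval c f = 0) :
    μ (X - C c) ≤ δ := by
  classical
  rw [← WithBot.coe_le_coe, ← hδ]
  refine Finset.le_max (Finset.mem_image_of_mem (fun c => μ (X - C c)) ?_)
  simp [hf, hc]

end Epsilon

/-! ### Key polynomials and minimal pairs -/

section Main

variable {K : Type*} [Field K] {L : Type*} [Field L] [Algebra K L] [IsAlgClosed L]
  [Algebra.IsAlgebraic K L]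
variable {Γ : Type*} [AddCommGroup Γ] [LinearOrder Γ] [IsOrderedAddMonoid Γ]
variable {ν : AddValuation K[X] (WithTop Γ)} {μ : AddValuation L[X] (WithTop Γ)}

omit [IsAlgClosed L] in
theorem finrank_adjoin_le {p : K[X]} (hp : p ≠ 0) {c : L} (hc : aeval c p = 0) :
    Module.finrank K (IntermediateField.adjoin K {c}) ≤ p.natDegree := by
  rw [IntermediateField.adjoin.finrank (Algebra.IsIntegral.isIntegral c)]
  exact natDegree_le_of_dvd (minpoly.dvd K c hc) hp

omit [IsAlgClosed L] in
theorem finrank_adjoin_eq {Q : K[X]} (hQ : Q.Monic) (hQirr : Irreducible Q) {a : L}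
    (ha : aeval a Q = 0) :
    Module.finrank K (IntermediateField.adjoin K {a}) = Q.natDegree := by
  rw [IntermediateField.adjoin.finrank (Algebra.IsIntegral.isIntegral a),
    ← minpoly.eq_of_irreducible_of_monic hQirr ha hQ]

theorem isKeyPolynomial_iff_isMinimalPair
    (hext : ∀ f : K[X], μ (f.map (algebraMap K L)) = ν f) (hμ : ∀ f : L[X], μ f = ⊤ → f = 0)
    {Q : K[X]} (hQ : Q.Monic) (hQirr : Irreducible Q) {δ : Γ}
    {a : L} (haQ : aeval a Q = 0) (ha : μ (X - C a) = δ)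
    (hδ : ∀ c : L, aeval c Q = 0 → μ (X - C c) ≤ δ) :
    IsKeyPolynomial ν Q ↔ IsMinimalPair K μ a δ := by
  have hQε := epsilon_eq_of_root hext hμ hQ.ne_zero haQ ha hδ
  have key : ∀ f : K[X], f.natDegree ≠ 0 → ∃ b : L, aeval b f = 0 ∧
      (∀ c : L, aeval c f = 0 → μ (X - C c) ≤ μ (X - C b)) ∧
      (epsilon ν Q ≤ epsilon ν f ↔ (δ : WithTop Γ) ≤ μ (X - C b)) := by
    intro f hf
    obtain ⟨b, hb, hmax⟩ := exists_max_root μ hf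
    refine ⟨b, hb, hmax, ?_⟩
    obtain ⟨γ, hγ⟩ := WithTop.ne_top_iff_exists.1 fun h => X_sub_C_ne_zero b (hμ _ h)
    rw [hQε, epsilon_eq_of_root hext hμ (by rintro rfl; simp at hf) hb hγ.symm
      (fun c hc => hγ ▸ hmax c hc), ← hγ, WithTop.coe_le_coe, WithBot.coe_le_coe,
      DivisibleHull.mk_le_mk]
    simp
  rw [IsMinimalPair, finrank_adjoin_eq hQ hQirr haQ]
  constructor
  · rintro ⟨-, h⟩
    refine ⟨AddSubgroup.subset_closure ⟨_, ha⟩, fun b hb => ?_⟩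
    have hint : IsIntegral K b := Algebra.IsIntegral.isIntegral b
    obtain ⟨c, -, hmax, hiff⟩ := key (minpoly K b) (minpoly.natDegree_pos hint).ne'
    rw [IntermediateField.adjoin.finrank hint]
    -- ε sees only the root c closest to X, and c is at least as close as b.
    refine h _ (hiff.2 (le_trans ?_ (hmax b (minpoly.aeval K b))))
    refine le_val_X_sub_C ha.ge ?_
    rwa [← neg_sub, C_neg, μ.map_neg]
  · rintro ⟨-, h⟩
    refine ⟨hQ, fun f hf => ?_⟩
    have hf0 : f.natDegree ≠ 0 := by
      intro h0
      rw [epsilon_of_natDegree_eq_zero ν h0, hQε] at hf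
      simp at hf
    obtain ⟨b, hb, -, hiff⟩ := key f hf0
    exact (h b (le_val_C_sub (hiff.1 hf) ha.ge)).trans
      (finrank_adjoin_le (by rintro rfl; simp at hf0) hb)

/-! ### Truncations -/

omit [IsAlgClosed L] [Algebra.IsAlgebraic K L] [Algebra K L] in
theorem val_lt_val_sum_sub_sum {ι : Type*} {s : Finset ι} {F G : ι → L[X]} {m : WithTop Γ}
    (hm : m ≠ ⊤) (hF : ∀ i ∈ s, m ≤ μ (F i))
    (hFG : ∀ i ∈ s, F i = G i ∨ μ (F i) < μ (F i - G i)) :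
    m < μ (∑ i ∈ s, F i - ∑ i ∈ s, G i) := by
  rw [← Finset.sum_sub_distrib]
  refine μ.map_lt_sum hm fun i hi => ?_
  rcases hFG i hi with h | h
  · rw [h, sub_self, μ.map_zero]
    exact lt_top_iff_ne_top.2 hm
  · exact (hF i hi).trans_lt h

omit [Algebra.IsAlgebraic K L] in
theorem eq_or_val_lt_map_sub_eval (hμ : ∀ f : L[X], μ f = ⊤ → f = 0) {p : K[X]} {b : L}
    (h : p ≠ 0 → ∀ c : L, aeval c p = 0 → μ (X - C c) < μ (X - C b)) :
    p.map (algebraMap K L) = C (aeval b p) ∨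
      μ (p.map (algebraMap K L)) < μ (p.map (algebraMap K L) - C (aeval b p)) := by
  by_cases hp : p = 0
  · simp [hp]
  · right
    rw [← eval_map_algebraMap]
    exact val_lt_val_sub_eval hμ ((Polynomial.map_ne_zero_iff (algebraMap K L).injective).2 hp)
      fun c hc => h hp c (by simpa [IsRoot, eval_map_algebraMap] using hc)

theorem eq_truncation_of_isMinimalPairOfDefinition
    (hext : ∀ f : K[X], μ (f.map (algebraMap K L)) = ν f) (hμ : ∀ f : L[X], μ f = ⊤ → f = 0)
    {Q : K[X]} (hQ : Q.Monic) (hQirr : Irreducible Q) {δ : Γ} {a : L} (haQ : aeval a Q = 0)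
    (h : IsMinimalPairOfDefinition K μ a δ) (p : K[X]) : ν p = truncation ν Q p := by
  obtain ⟨⟨-, hmin⟩, ha, hmax⟩ := h
  rw [finrank_adjoin_eq hQ hQirr haQ] at hmin
  have hsum := sum_expansionCoeff hQirr.natDegree_pos p
  set y := Q.map (algebraMap K L) with hy
  set q := expansionCoeff Q p
  set n := p.natDegree + 1
  have hya : y.eval a = 0 := by rwa [hy, eval_map_algebraMap]
  -- Since y vanishes at a, evaluating y - d there bounds its value by that of d.
  have hyd : ∀ d : L, μ (y - C d) ≤ μ y := by
    intro d
    have h1 : μ (y - C d) ≤ μ (C d) := by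
      have := val_le_val_C_eval (fun b => ha ▸ hmax b) (y - C d)
      rwa [eval_sub, hya, eval_C, zero_sub, C_neg, μ.map_neg] at this
    simpa using μ.map_le_add le_rfl h1
  have hy0 : y ≠ 0 := (Polynomial.map_ne_zero_iff (algebraMap K L).injective).2 hQ.ne_zero
  have hq : ∀ i, (q i).map (algebraMap K L) = C (aeval a (q i)) ∨
      μ ((q i).map (algebraMap K L)) < μ ((q i).map (algebraMap K L) - C (aeval a (q i))) := by
    intro i
    refine eq_or_val_lt_map_sub_eval hμ fun h0 c hc => ?_
    -- Such a root c would satisfy μ(c - a) ≥ δ with degree over K below deg Q.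
    by_contra! hlt
    have h1 := (hmin c (le_val_C_sub (ha ▸ hlt) ha.ge)).trans (finrank_adjoin_le h0 hc)
    exact absurd (natDegree_lt_natDegree h0 (degree_expansionCoeff_lt hQ.ne_zero p i)) h1.not_gt
  set F : ℕ → L[X] := fun i => (q i).map (algebraMap K L) * y ^ i
  set G : ℕ → L[X] := fun i => C (aeval a (q i)) * y ^ i
  have hF : ∀ i, μ (F i) = ν (q i * Q ^ i) := by
    intro i
    rw [← hext]
    simp [F, y]
  have hFsum : μ (∑ i ∈ Finset.range n, F i) = ν p := by
    rw [← hext, ← hsum, Polynomial.map_sum]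
    simp [F, y]
  have hFG : ∀ i ∈ Finset.range n, F i = G i ∨ μ (F i) < μ (F i - G i) := by
    intro i _
    rcases hq i with h | h
    · exact Or.inl (by simp only [F, G, h])
    · right
      have : F i - G i = ((q i).map (algebraMap K L) - C (aeval a (q i))) * y ^ i := by
        simp only [F, G]
        ring
      rw [this, μ.map_mul, μ.map_mul]
      exact WithTop.add_lt_add_right (fun h => pow_ne_zero i hy0 (hμ _ h)) h
  have hG : ∀ i ∈ Finset.range n, μ (∑ i ∈ Finset.range n, G i) ≤ μ (G i) := by
    intro i hi
    have := val_comp_le hyd (∑ i ∈ Finset.range n, monomial i (aeval a (q i))) i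
    rw [Polynomial.sum_comp] at this
    simpa [finsetSum_coeff, coeff_monomial, Finset.mem_range.1 hi, G] using this
  obtain ⟨j, hj, hjmin⟩ := Finset.exists_min_image (Finset.range n) (fun i => μ (F i))
    ⟨0, by simp [n]⟩
  have hFGj : μ (F j) = μ (G j) := by
    rcases hFG j hj with h | h
    · rw [h]
    · exact (μ.map_eq_of_lt_sub (by rwa [μ.map_sub_swap])).symm
  refine le_antisymm ?_ ?_
  · refine Finset.le_inf fun i hi => ?_
    refine le_trans ?_ ((hjmin i hi).trans_eq (hF i))
    -- If ν p exceeded the least term value, so would the sum of the G i, whose error against the F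
    -- i is also larger; but that sum has value at most μ (G j).
    by_contra! hlt
    rw [← hFsum] at hlt
    have h1 := val_lt_val_sum_sub_sum (ne_top_of_lt hlt) hjmin hFG
    have h2 := val_lt_val_sub hlt h1
    rw [sub_sub_cancel] at h2
    exact absurd (hG j hj) (hFGj ▸ h2).not_ge
  · conv_rhs => rw [← hsum]
    exact ν.map_le_sum fun i hi => Finset.inf_le hi

theorem val_X_sub_C_le_of_eq_truncation
    (hext : ∀ f : K[X], μ (f.map (algebraMap K L)) = ν f) (hμ : ∀ f : L[X], μ f = ⊤ → f = 0)
    {Q : K[X]} (hQ : Q.Monic) (hQirr : Irreducible Q) {a : L}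
    (hmax : ∀ c : L, aeval c Q = 0 → μ (X - C c) ≤ μ (X - C a))
    (h : ∀ p : K[X], ν p = truncation ν Q p) (b : L) : μ (X - C b) ≤ μ (X - C a) := by
  by_contra! hb
  -- With b of least degree, nonzero polynomials of degree below that of its minimal polynomial have
  -- no root as close to X as b.
  induction hn : (minpoly K b).natDegree using Nat.strong_induction_on generalizing b with
  | _ n ih
  have hint : IsIntegral K b := Algebra.IsIntegral.isIntegral b
  set f := minpoly K b with hf
  have hf0 : f ≠ 0 := minpoly.ne_zero hint
  have hsmall : ∀ p : K[X], p.degree < f.degree → p ≠ 0 →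
      ∀ c : L, aeval c p = 0 → μ (X - C c) < μ (X - C b) := by
    intro p hp hp0 c hc
    by_contra! hlt
    refine ih _ ?_ c (hb.trans_le hlt) rfl
    rw [← hn]
    exact (natDegree_le_of_dvd (minpoly.dvd K c hc) hp0).trans_lt (natDegree_lt_natDegree hp0 hp)
  have hQb : ∀ c : L, aeval c Q = 0 → μ (X - C c) < μ (X - C b) :=
    fun c hc => (hmax c hc).trans_lt hb
  have hQ0 : Q.map (algebraMap K L) ≠ 0 :=
    (Polynomial.map_ne_zero_iff (algebraMap K L).injective).2 hQ.ne_zero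
  have hQval := val_lt_val_sub_eval hμ hQ0
    fun c hc => hQb c (by simpa [IsRoot, eval_map_algebraMap] using hc)
  rw [eval_map_algebraMap] at hQval
  have hQval' : μ (C (aeval b Q)) = μ (Q.map (algebraMap K L)) :=
    μ.map_eq_of_lt_sub (by rwa [μ.map_sub_swap])
  rcases le_or_gt Q.degree f.degree with hdeg | hdeg
  · have hsum := sum_expansionCoeff hQirr.natDegree_pos f
    have hlt := val_lt_val_sum_sub_sum (m := ν f) (μ := μ) (s := Finset.range (f.natDegree + 1))
      (F := fun i => (expansionCoeff Q f i * Q ^ i).map (algebraMap K L))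
      (G := fun i => C (aeval b (expansionCoeff Q f i * Q ^ i)))
      (fun h => hf0 ((Polynomial.map_eq_zero (algebraMap K L)).1 (hμ _ ((hext f).trans h)))) ?_ ?_
    · rw [← Polynomial.map_sum, ← map_sum C, ← map_sum (aeval b), hsum, hf, minpoly.aeval, C_0,
        sub_zero, hext] at hlt
      exact lt_irrefl _ hlt
    · intro i hi
      simp only [hext]
      rw [h f]
      exact Finset.inf_le hi
    · intro i _
      refine eq_or_val_lt_map_sub_eval hμ fun hp c hc => ?_
      rw [map_mul, map_pow] at hc
      rcases mul_eq_zero.1 hc with hc | hc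
      · exact hsmall _ ((degree_expansionCoeff_lt hQ.ne_zero f i).trans_le hdeg)
          (left_ne_zero_of_mul hp) c hc
      · exact hQb c (eq_zero_of_pow_eq_zero hc)
  · have hr := eq_or_val_lt_map_sub_eval hμ (hsmall (Q % f) (EuclideanDomain.mod_lt _ hf0))
    have hrb : aeval b (Q % f) = aeval b Q := by
      conv_rhs => rw [← EuclideanDomain.mod_add_div Q f]
      simp [hf]
    rw [hrb] at hr
    have hrval : μ ((Q % f).map (algebraMap K L)) = μ (Q.map (algebraMap K L)) := by
      rw [← hQval']
      rcases hr with hr | hr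
      · rw [hr]
      · exact (μ.map_eq_of_lt_sub (by rwa [μ.map_sub_swap])).symm
    have hdiff : μ (Q.map (algebraMap K L)) < μ ((Q - Q % f).map (algebraMap K L)) := by
      have : (Q - Q % f).map (algebraMap K L) = (Q.map (algebraMap K L) - C (aeval b Q)) -
          ((Q % f).map (algebraMap K L) - C (aeval b Q)) := by
        rw [Polynomial.map_sub]
        ring
      rw [this]
      refine val_lt_val_sub hQval ?_
      rcases hr with hr | hr
      · rw [hr, sub_self, μ.map_zero]
        exact lt_top_iff_ne_top.2 fun h => hQ0 (hμ _ h)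
      · rwa [hrval] at hr
    -- The Q-expansion of this difference has constant coefficient -(Q % f), so its truncated value
    -- is at most that of Q % f, which is ν Q.
    refine absurd hdiff (not_lt.2 ?_)
    rw [hext, h]
    refine (Finset.inf_le (Finset.mem_range.2 (Nat.succ_pos _))).trans_eq ?_
    have : (Q - Q % f) % Q = -(Q % f) := by
      rw [sub_mod, EuclideanDomain.mod_self, zero_sub,
        (mod_eq_self_iff hQ.ne_zero).2 ((EuclideanDomain.mod_lt _ hf0).trans hdeg)]
    simp only [expansionCoeff, Function.iterate_zero, id, pow_zero, mul_one, this, ν.map_neg]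
    rw [← hext, hrval]

end Main

end KeyPoly

theorem theorem1p1
    {K : Type*} [Field K] {L : Type*} [Field L] [Algebra K L] [IsAlgClosure K L]
    {Γ : Type*} [AddCommGroup Γ] [LinearOrder Γ] [IsOrderedAddMonoid Γ]
    (ν : AddValuation K[X] (WithTop Γ)) (hν : ∀ f : K[X], ν f = ⊤ → f = 0)
    (μ : AddValuation L[X] (WithTop Γ)) (hμ : ∀ f : K[X], μ (f.map (algebraMap K L)) = ν f)
    (Q : K[X]) (hQ : Q.Monic) (hQirr : Irreducible Q)
    (δ : Γ) (hδ : KeyPoly.delta μ Q = ((δ : WithTop Γ) : WithBot (WithTop Γ)))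
    (a : L) (haQ : aeval a Q = 0) (ha : μ (X - C a) = (δ : WithTop Γ)) :
    (KeyPoly.IsKeyPolynomial ν Q ↔ KeyPoly.IsMinimalPair K μ a δ) ∧
    (KeyPoly.IsKeyPolynomial ν Q →
      (KeyPoly.IsMinimalPairOfDefinition K μ a δ ↔ ∀ p : K[X], ν p = KeyPoly.truncation ν Q p)) ∧
    (KeyPoly.IsMinimalPairOfDefinition K μ a δ → ∀ p : K[X], ν p = KeyPoly.truncation ν Q p) ∧
    ((∀ p : K[X], ν p = KeyPoly.truncation ν Q p) → ∀ b : L, μ (X - C b) ≤ μ (X - C a)) := by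
  have : IsAlgClosed L := IsAlgClosure.isAlgClosed K
  have : Algebra.IsAlgebraic K L := IsAlgClosure.isAlgebraic
  have hμ0 := KeyPoly.eq_zero_of_val_eq_top hν hμ
  have hmax : ∀ c : L, aeval c Q = 0 → μ (X - C c) ≤ δ :=
    fun c hc => KeyPoly.val_le_of_delta_eq hQ.ne_zero hδ hc
  have hiff := KeyPoly.isKeyPolynomial_iff_isMinimalPair hμ hμ0 hQ hQirr haQ ha hmax
  have htrunc := KeyPoly.eq_truncation_of_isMinimalPairOfDefinition hμ hμ0 hQ hQirr (δ := δ) haQ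
  have hle : (∀ p : K[X], ν p = KeyPoly.truncation ν Q p) → ∀ b : L, μ (X - C b) ≤ μ (X - C a) :=
    KeyPoly.val_X_sub_C_le_of_eq_truncation hμ hμ0 hQ hQirr fun c hc => ha ▸ hmax c hc
  exact ⟨hiff, fun hkey => ⟨htrunc, fun h => ⟨hiff.1 hkey, ha, fun b => ha ▸ hle h b⟩⟩, htrunc, hle⟩
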